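/- **Proposition 2.1.** Let $(M,g,J)$ be a Kähler manifold of real dimension $2n\ge 4$ with Levi-Civita connection $\nabla$. Let $\mathcal F$ be a foliation of $M$ by surfaces (real $2$-dimensional leaves) with tangent distribution $\mathcal D$, and let $\mathcal E=\mathcal D^{\perp}$. Assume that - $\mathcal F$ is complex: $J\mathcal D=\mathcal D$; - $\mathcal F$ is homothetic: there is a smooth one-form $\alpha$ with $d\alpha=0$, vanishing on $\mathcal E$, such that $(L_Vg)(X,Y)=\alpha(V)\,g(X,Y)$ for all local sections $V$ of $\mathcal D$ and all $X,Y\in\mathcal E$; - $\mathcal F$ is totally geodesic: $\nabla_XY\in\Gamma(\mathcal D)$ for all $X,Y\in\Gamma(\mathcal D)$; - $\mathcal F$ is holomorphic: $(L_XJ)(TM)\subset\mathcal D$ for all $X\in\Gamma(\mathcal D)$. Let $U=\{x\in M:\alpha_x\neq 0\}$. For a section $X$ of $\mathcal D$ write $\operatorname{div}_{\mathcal E}X=\sum_i g(\nabla_{e_i}X,e_i)$, where $(e_i)$ is an orthonormal basis of $\mathcal E$. Let $\kappa=\sqrt{(\operatorname{div}_{\mathcal E}X)^2+(\operatorname{div}_{\mathcal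 E}JX)^2}$ for any local unit section $X$ of $\mathcal D$; this does not depend on the choice of $X$. Let $\xi$ be the principal field on $U$, i.e. the smooth unit section of $\mathcal D$ over $U$ with $\operatorname{div}_{\mathcal E}J\xi=0$ and $\operatorname{div}_{\mathcal E}\xi=\kappa$. Put $\eta(X)=g(\xi,X)$, $J\eta(X)=g(J\xi,X)$ and $m(X,Y)=g(p_{\mathcal E}X,p_{\mathcal E}Y)$, where $p_{\mathcal E}$ is the orthogonal projection onto $\mathcal E$. Then there is a function $p^*\in C^\infty(U)$ with $\nabla_{J\xi}J\xi=p^*\xi$, and on $U$ $$d\eta=0,\qquad \nabla_\xi\xi=0,\qquad d\ln|\alpha|=-(|\alpha|+p^*)\,\eta,\qquad dp^*\wedge\eta=0,$$ $$(\nabla_X\eta)(Y)=\tfrac12|\alpha|\,m(X,Y)-p^*\,J\eta(X)\,J\eta(Y)\quad\text{for all } X,Y\in TU .$$ -/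

import Mathlib

open Set Bundle
open scoped Manifold ContDiff

namespace HomotheticFoliation

noncomputable section

variable {E : Type*} [NormedAddCommGroup E] [NormedSpace ℝ E] [FiniteDimensional ℝ E]
  {M : Type*} [TopologicalSpace M] [ChartedSpace E M] [IsManifold 𝓘(ℝ, E) ∞ M]

section Fields

variable (E M) in
/-- Vector fields, as arbitrary choices of a tangent vector at each point (no smoothness). Local
vector fields are such choices for which only the values on an open set matter. -/
abbrev VecField := (x : M) → TangentSpace 𝓘(ℝ, E) x

variable (E M) in
/-- One-forms, as arbitrary choices of a covector at each point (no smoothness). -/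
abbrev OneForm := (x : M) → (TangentSpace 𝓘(ℝ, E) x →L[ℝ] ℝ)

variable (E M) in
/-- Fields of endomorphisms of the tangent spaces (no smoothness). -/
abbrev EndField := (x : M) → (TangentSpace 𝓘(ℝ, E) x →L[ℝ] TangentSpace 𝓘(ℝ, E) x)

variable (E M) in
/-- Choices of a linear subspace of each tangent space (no smoothness). -/
abbrev TangentDistribution := (x : M) → Submodule ℝ (TangentSpace 𝓘(ℝ, E) x)

/-- The vector field `X` is smooth on `O`. -/
def SmoothOn (X : VecField E M) (O : Set M) : Prop :=
  ContMDiffOn 𝓘(ℝ, E) (𝓘(ℝ, E).prod 𝓘(ℝ, E)) ∞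
    (fun x => TotalSpace.mk' E (E := fun y : M => TangentSpace 𝓘(ℝ, E) y) x (X x)) O

/-- The one-form `α` is smooth: it is a smooth section of the cotangent bundle. -/
def SmoothForm (α : OneForm E M) : Prop :=
  ContMDiff 𝓘(ℝ, E) (𝓘(ℝ, E).prod 𝓘(ℝ, E →L[ℝ] ℝ)) ∞
    (fun x => TotalSpace.mk' (E →L[ℝ] ℝ)
      (E := fun y : M => TangentSpace 𝓘(ℝ, E) y →L[ℝ] Trivial M ℝ y) x (α x))

/-- The field of endomorphisms `J` is smooth: it is a smooth section of `End(TM)`. -/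
def SmoothEnd (J : EndField E M) : Prop :=
  ContMDiff 𝓘(ℝ, E) (𝓘(ℝ, E).prod 𝓘(ℝ, E →L[ℝ] E)) ∞
    (fun x => TotalSpace.mk' (E →L[ℝ] E)
      (E := fun y : M => TangentSpace 𝓘(ℝ, E) y →L[ℝ] TangentSpace 𝓘(ℝ, E) y) x (J x))

/-- The derivative of the function `f` at `x` in the direction `v`. -/
def dirDeriv (f : M → ℝ) (x : M) (v : TangentSpace 𝓘(ℝ, E) x) : ℝ :=
  mfderiv 𝓘(ℝ, E) 𝓘(ℝ, ℝ) f x v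

/-- The Lie bracket `[X, Y]`. -/
def bracket (X Y : VecField E M) : VecField E M := VectorField.mlieBracket 𝓘(ℝ, E) X Y

/-- The vector field `J X`. -/
def app (J : EndField E M) (X : VecField E M) : VecField E M := fun x => J x (X x)

/-- The exterior derivative of a one-form,
`dα(X, Y) = X (α Y) - Y (α X) - α [X, Y]`. -/
def extDerivForm (α : OneForm E M) (X Y : VecField E M) (x : M) : ℝ :=
  dirDeriv (fun y => α y (Y y)) x (X x) - dirDeriv (fun y => α y (X y)) x (Y x)
    - α x (bracket X Y x)

/-- `dα = 0` on the open set `U`. -/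
def IsClosedFormOn (α : OneForm E M) (U : Set M) : Prop :=
  ∀ (O : Set M), IsOpen O → O ⊆ U → ∀ X Y : VecField E M, SmoothOn X O → SmoothOn Y O →
    ∀ x ∈ O, extDerivForm α X Y x = 0

/-- `X` is a smooth section of the distribution `D` over `O`. -/
def IsSectionOn (D : TangentDistribution E M) (X : VecField E M) (O : Set M) : Prop :=
  SmoothOn X O ∧ ∀ x ∈ O, X x ∈ D x

/-- `D` is the tangent distribution of a foliation with `k`-dimensional leaves: it is a smooth
subbundle of `TM` of rank `k` which is involutive. By the theorem of Frobenius this is the same as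
a foliation. -/
structure IsFoliation (k : ℕ) (D : TangentDistribution E M) : Prop where
  finrank_eq : ∀ x, Module.finrank ℝ (D x) = k
  exists_frame : ∀ x, ∃ O : Set M, IsOpen O ∧ x ∈ O ∧ ∃ e : Fin k → VecField E M,
    (∀ i, SmoothOn (e i) O) ∧ ∀ y ∈ O, D y = Submodule.span ℝ (range fun i => e i y)
  involutive : ∀ (O : Set M), IsOpen O → ∀ X Y : VecField E M, IsSectionOn D X O →
    IsSectionOn D Y O → ∀ x ∈ O, bracket X Y x ∈ D x

/-- The distribution `D` is complex: `J D = D` (equivalently, as `J² = -1`, `J D ⊆ D`). -/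
def IsComplex (J : EndField E M) (D : TangentDistribution E M) : Prop :=
  ∀ x, ∀ v ∈ D x, J x v ∈ D x

/-- The distribution `D` is holomorphic: `(L_X J) TM ⊆ D` for every local section `X` of `D`,
where `(L_X J) Y = [X, J Y] - J [X, Y]`. -/
def IsHolomorphic (J : EndField E M) (D : TangentDistribution E M) : Prop :=
  ∀ (O : Set M), IsOpen O → ∀ X Y : VecField E M, IsSectionOn D X O → SmoothOn Y O →
    ∀ x ∈ O, bracket X (app J Y) x - J x (bracket X Y x) ∈ D x

end Fields

section Metric

variable [RiemannianBundle (fun x : M => TangentSpace 𝓘(ℝ, E) x)]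
  [IsContMDiffRiemannianBundle 𝓘(ℝ, E) ∞ E (fun x : M => TangentSpace 𝓘(ℝ, E) x)]

variable (E M) in
/-- Connections on the tangent bundle. -/
abbrev Connection := CovariantDerivative 𝓘(ℝ, E) E (fun x : M => TangentSpace 𝓘(ℝ, E) x)

/-- `∇` is the Levi-Civita connection of the Riemannian metric: the smooth connection on `TM`
which is torsion free and compatible with the metric. In `nabla Y x v` the derivative at `x` of the
vector field `Y` is taken in the direction `v`. -/
structure IsLeviCivita (nabla : Connection E M) : Prop where
  smooth : CovariantDerivative.ContMDiffCovariantDerivative nabla ∞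
  torsion_eq_zero : nabla.torsion = 0
  metric : CovariantDerivative.IsMetricCompatible (V := fun x : M => TangentSpace 𝓘(ℝ, E) x) nabla

/-- `(M, g, J)` is a Kähler manifold with Levi-Civita connection `nabla`: `J` is a smooth almost
complex structure which is orthogonal with respect to `g` and parallel. -/
structure IsKahler (nabla : Connection E M) (J : EndField E M) : Prop where
  leviCivita : IsLeviCivita nabla
  smooth : SmoothEnd J
  sq_eq_neg : ∀ x (v : TangentSpace 𝓘(ℝ, E) x), J x (J x v) = -v
  orthogonal : ∀ x (v w : TangentSpace 𝓘(ℝ, E) x), inner ℝ (J x v) (J x w) = inner ℝ v w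
  parallel : ∀ (O : Set M), IsOpen O → ∀ Y : VecField E M, SmoothOn Y O →
    ∀ x ∈ O, ∀ v : TangentSpace 𝓘(ℝ, E) x, nabla (app J Y) x v = J x (nabla Y x v)

/-- The Lie derivative of the metric,
`(L_V g)(X, Y) = V (g(X, Y)) - g([V, X], Y) - g(X, [V, Y])`. -/
def lieMetric (V X Y : VecField E M) (x : M) : ℝ :=
  dirDeriv (fun y => inner ℝ (X y) (Y y)) x (V x) - inner ℝ (bracket V X x) (Y x)
    - inner ℝ (X x) (bracket V Y x)

/-- The foliation with tangent distribution `D` is conformal with one-form `α`: `α` is a smooth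
one-form vanishing on `Dᗮ`, and `L_V g = α(V) g` holds on `Dᗮ` for all local sections `V`
of `D`. -/
structure IsConformal (D : TangentDistribution E M) (α : OneForm E M) : Prop where
  smooth : SmoothForm α
  vanish : ∀ x, ∀ v ∈ (D x)ᗮ, α x v = 0
  lie_eq : ∀ (O : Set M), IsOpen O → ∀ V X Y : VecField E M, IsSectionOn D V O →
    SmoothOn X O → SmoothOn Y O → ∀ x ∈ O, X x ∈ (D x)ᗮ → Y x ∈ (D x)ᗮ →
      lieMetric V X Y x = α x (V x) * inner ℝ (X x) (Y x)

/-- The foliation with tangent distribution `D` is homothetic with one-form `α`: it is conformal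
and `dα = 0`. -/
def IsHomothetic (D : TangentDistribution E M) (α : OneForm E M) : Prop :=
  IsConformal D α ∧ IsClosedFormOn α univ

/-- The foliation with tangent distribution `D` is totally geodesic: `∇_X Y` is a section of `D`
for all local sections `X`, `Y` of `D`. -/
def IsTotallyGeodesic (nabla : Connection E M) (D : TangentDistribution E M) : Prop :=
  ∀ (O : Set M), IsOpen O → ∀ X Y : VecField E M, IsSectionOn D X O → IsSectionOn D Y O →
    ∀ x ∈ O, nabla Y x (X x) ∈ D x

/-- The dual one-form of a vector field, `X♭(Y) = g(X, Y)`. -/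
def flat (X : VecField E M) : OneForm E M := fun x => innerSL ℝ (X x)

/-- The orthogonal projection of `T_x M` onto the orthogonal complement of `D x`. -/
def projPerp (D : TangentDistribution E M) (x : M) :
    TangentSpace 𝓘(ℝ, E) x →L[ℝ] TangentSpace 𝓘(ℝ, E) x :=
  haveI : FiniteDimensional ℝ (TangentSpace 𝓘(ℝ, E) x) :=
    inferInstanceAs (FiniteDimensional ℝ E)
  ((D x)ᗮ).starProjection

/-- The tensor `m(v, w) = g(p v, p w)`, where `p` is the orthogonal projection onto `Dᗮ`. -/
def metricPerp (D : TangentDistribution E M) (x : M) (v w : TangentSpace 𝓘(ℝ, E) x) : ℝ :=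
  inner ℝ (projPerp D x v) (projPerp D x w)

/-- The divergence of `X` along `Dᗮ`, that is `∑ g(∇_{e_i} X, e_i)` over an orthonormal basis
`(e_i)` of `Dᗮ`, written as the trace of the endomorphism `p ∘ ∇X ∘ p` where `p` is the
orthogonal projection onto `Dᗮ`. -/
def divPerp (nabla : Connection E M) (D : TangentDistribution E M) (X : VecField E M) (x : M) : ℝ :=
  LinearMap.trace ℝ (TangentSpace 𝓘(ℝ, E) x)
    (projPerp D x ∘L nabla X x ∘L projPerp D x : TangentSpace 𝓘(ℝ, E) x →L[ℝ] _).toLinearMap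

/-- The function `κ = √((div X)² + (div JX)²)`, with divergences along `Dᗮ`, for a local unit
section `X` of `D` (it does not depend on the choice of `X`). -/
def kappa (nabla : Connection E M) (J : EndField E M) (D : TangentDistribution E M) (X : VecField E M)
    (x : M) : ℝ :=
  Real.sqrt (divPerp nabla D X x ^ 2 + divPerp nabla D (app J X) x ^ 2)

/-- `ξ` is the principal field of `D` on the open set `U`, on which `κ ≠ 0`: the smooth unit
section of `D` over `U` with `div (Jξ) = 0` and `div ξ = κ` along `Dᗮ`. -/
structure IsPrincipalFieldOn (nabla : Connection E M) (J : EndField E M) (D : TangentDistribution E M)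
    (U : Set M) (ξ : VecField E M) : Prop where
  isSection : IsSectionOn D ξ U
  norm_eq_one : ∀ x ∈ U, ‖ξ x‖ = 1
  div_J_eq_zero : ∀ x ∈ U, divPerp nabla D (app J ξ) x = 0
  div_eq : ∀ x ∈ U, divPerp nabla D ξ x = kappa nabla J D ξ x

/-- The covariant derivative of a one-form,
`(∇_X η)(Y) = X (η Y) - η (∇_X Y)`, at the point `x`. -/
def covDerivForm (nabla : Connection E M) (η : OneForm E M) (X Y : VecField E M) (x : M) : ℝ :=
  dirDeriv (fun y => η y (Y y)) x (X x) - η x (nabla Y x (X x))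

/-- The open set where the one-form `α` does not vanish. -/
def nonvanishing (α : OneForm E M) : Set M := {x | α x ≠ 0}

end Metric

end

end HomotheticFoliation

open HomotheticFoliation

/-! Write c = α(ξ), η = ξ♭, E = Dᗮ. For a section X of D, the homothety condition fixes the
symmetric part of ∇X on E as α(X)/2, and likewise for JX. Holomorphy makes the E-part of ∇X commute
with J, so on E it is the complex multiple given in `inner_nabla_eq`. Taking traces, the principal
field satisfies α(Jξ) = 0 and c > 0; hence α = cη and c = |α|.

Evaluate dα = dc ∧ η + c dη = 0 on pairs from E, ξ, Jξ, using that ∇ξ preserves D: dc vanishes on E,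
∇ξ sends E into E, and dc(Jξ) is c times the Jξ-component of ∇_ξ ξ. For Y in E, [Y, JY] has
Jξ-component -c|Y|² and no ξ-component (`inner_bracket_orthogonal`). Since dc kills E, it kills [Y,
JY] and so Jξ; therefore ∇_ξ ξ = 0. Now ∇ξ is known up to p = g(Jξ, [ξ, Jξ]), and its symmetry is dη
= 0.

The Jξ-component of the Jacobi identity for ξ, Y, JY gives ξ(c) = -c(c + p) (`dirDeriv_alpha_self`),
so dc = -c(c + p)η. Finally d(dc) = 0 with dη = 0 and dc ∧ η = 0 leaves c dp ∧ η = 0. -/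

namespace HomotheticFoliation

set_option linter.unusedSectionVars false

/-! ### Smooth local fields, directional derivatives and Lie brackets. -/

section Calculus

variable {E : Type*} [NormedAddCommGroup E] [NormedSpace ℝ E] [FiniteDimensional ℝ E]
  {M : Type*} [TopologicalSpace M] [ChartedSpace E M] [IsManifold 𝓘(ℝ, E) ∞ M]
  {O : Set M} {X Y Z W : VecField E M} {f g : M → ℝ} {x : M}

theorem SmoothOn.mono {O' : Set M} (hX : SmoothOn X O) (h : O' ⊆ O) : SmoothOn X O' :=
  ContMDiffOn.mono hX h

theorem SmoothOn.congr (hX : SmoothOn X O) (h : ∀ y ∈ O, Y y = X y) : SmoothOn Y O :=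
  ContMDiffOn.congr hX fun y hy => by rw [h y hy]

theorem SmoothOn.contMDiffAt (hX : SmoothOn X O) (hO : IsOpen O) (hx : x ∈ O) :
    ContMDiffAt 𝓘(ℝ, E) (𝓘(ℝ, E).prod 𝓘(ℝ, E)) ∞
      (fun x => TotalSpace.mk' E (E := fun y : M => TangentSpace 𝓘(ℝ, E) y) x (X x)) x :=
  ContMDiffOn.contMDiffAt hX (hO.mem_nhds hx)

theorem SmoothOn.mdifferentiableAt (hX : SmoothOn X O) (hO : IsOpen O) (hx : x ∈ O) :
    MDifferentiableAt 𝓘(ℝ, E) (𝓘(ℝ, E).prod 𝓘(ℝ, E))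
      (fun x => TotalSpace.mk' E (E := fun y : M => TangentSpace 𝓘(ℝ, E) y) x (X x)) x :=
  (hX.contMDiffAt hO hx).mdifferentiableAt (by simp)

theorem SmoothOn.add (hX : SmoothOn X O) (hY : SmoothOn Y O) : SmoothOn (X + Y) O :=
  ContMDiffOn.add_section hX hY

theorem SmoothOn.sub (hX : SmoothOn X O) (hY : SmoothOn Y O) : SmoothOn (X - Y) O :=
  ContMDiffOn.sub_section hX hY

theorem SmoothOn.smul (hX : SmoothOn X O) (hf : ContMDiffOn 𝓘(ℝ, E) 𝓘(ℝ, ℝ) ∞ f O) :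
    SmoothOn (f • X) O :=
  ContMDiffOn.smul_section hf hX

theorem SmoothOn.bracket (hX : SmoothOn X O) (hY : SmoothOn Y O) (hO : IsOpen O) :
    SmoothOn (bracket X Y) O := fun _ hx =>
  haveI : IsManifold 𝓘(ℝ, E) (minSmoothness ℝ 2) M :=
    IsManifold.of_le (n := ∞) (by
      simpa using WithTop.coe_le_coe.2 (le_top : (2 : ℕ∞) ≤ ⊤))
  haveI : IsManifold 𝓘(ℝ, E) (((⊤ : ℕ∞) : WithTop ℕ∞) + 1) M := ‹IsManifold 𝓘(ℝ, E) ∞ M›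
  (ContMDiffAt.mlieBracket_vectorField (m := ⊤) (n := ⊤) (hX.contMDiffAt hO hx)
    (hY.contMDiffAt hO hx) (by simp)).contMDiffWithinAt

theorem SmoothOn.app {J : EndField E M} (hJ : SmoothEnd J) (hX : SmoothOn X O) :
    SmoothOn (app J X) O :=
  ContMDiffOn.clm_bundle_apply (E₁ := fun y : M => TangentSpace 𝓘(ℝ, E) y)
    (E₂ := fun y : M => TangentSpace 𝓘(ℝ, E) y) (b := fun y => y) (hJ.contMDiffOn) hX

theorem SmoothForm.contMDiffOn_apply {α : OneForm E M} (hα : SmoothForm α) (hX : SmoothOn X O) :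
    ContMDiffOn 𝓘(ℝ, E) 𝓘(ℝ, ℝ) ∞ (fun y => α y (X y)) O := by
  have h := ContMDiffOn.clm_bundle_apply (E₁ := fun y : M => TangentSpace 𝓘(ℝ, E) y)
    (E₂ := fun y : M => Trivial M ℝ y) (b := fun y => y) (hα.contMDiffOn (s := O)) hX
  intro y hy
  have := (contMDiffWithinAt_totalSpace.1 (h y hy)).2
  exact this

/-- Hypotheses about local fields become pointwise identities in tangent vectors by applying them to
such extensions. -/
theorem exists_smoothOn_eq (hO : IsOpen O) (hx : x ∈ O) (v : TangentSpace 𝓘(ℝ, E) x) :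
    ∃ O' ⊆ O, IsOpen O' ∧ x ∈ O' ∧ ∃ X : VecField E M, SmoothOn X O' ∧ X x = v := by
  obtain ⟨s, hs, h⟩ := FiberBundle.exists_contMDiffOn_extend (k := ∞) 𝓘(ℝ, E) E
    (V := fun y : M => TangentSpace 𝓘(ℝ, E) y) v
  obtain ⟨t, hts, ht, hxt⟩ := mem_nhds_iff.1 hs
  exact ⟨t ∩ O, inter_subset_right, ht.inter hO, ⟨hxt, hx⟩, _,
    h.mono (inter_subset_left.trans hts), FiberBundle.extend_apply_self E v⟩

theorem _root_.ContMDiffOn.mdifferentiableAt_of_isOpen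
    (hf : ContMDiffOn 𝓘(ℝ, E) 𝓘(ℝ, ℝ) ∞ f O) (hO : IsOpen O) (hx : x ∈ O) :
    MDifferentiableAt 𝓘(ℝ, E) 𝓘(ℝ, ℝ) f x :=
  (hf.contMDiffAt (hO.mem_nhds hx)).mdifferentiableAt (by simp)

theorem dirDeriv_congr (hO : IsOpen O) (hx : x ∈ O) (h : ∀ y ∈ O, f y = g y)
    (v : TangentSpace 𝓘(ℝ, E) x) : dirDeriv f x v = dirDeriv g x v := by
  have : f =ᶠ[nhds x] g := Filter.eventually_of_mem (hO.mem_nhds hx) h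
  unfold dirDeriv
  rw [this.mfderiv_eq]
  rfl

theorem dirDeriv_add_vec (v w : TangentSpace 𝓘(ℝ, E) x) :
    dirDeriv f x (v + w) = dirDeriv f x v + dirDeriv f x w :=
  map_add (mvfderiv 𝓘(ℝ, E) f x) v w

theorem dirDeriv_smul_vec (a : ℝ) (v : TangentSpace 𝓘(ℝ, E) x) :
    dirDeriv f x (a • v) = a * dirDeriv f x v :=
  map_smul (mvfderiv 𝓘(ℝ, E) f x) a v

theorem dirDeriv_const (a : ℝ) (v : TangentSpace 𝓘(ℝ, E) x) :
    dirDeriv (fun _ => a) x v = 0 :=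
  congr($(mvfderiv_const (I := 𝓘(ℝ, E)) a (x := x)) v)

theorem dirDeriv_neg (v : TangentSpace 𝓘(ℝ, E) x) :
    dirDeriv (fun y => -f y) x v = -dirDeriv f x v :=
  congr($(mvfderiv_neg (I := 𝓘(ℝ, E)) (g := f) (x := x)) v)

theorem dirDeriv_add (hf : MDifferentiableAt 𝓘(ℝ, E) 𝓘(ℝ, ℝ) f x)
    (hg : MDifferentiableAt 𝓘(ℝ, E) 𝓘(ℝ, ℝ) g x) (v : TangentSpace 𝓘(ℝ, E) x) :
    dirDeriv (fun y => f y + g y) x v = dirDeriv f x v + dirDeriv g x v :=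
  congr($(mvfderiv_add (I := 𝓘(ℝ, E)) hf hg) v)

theorem dirDeriv_mul (hf : MDifferentiableAt 𝓘(ℝ, E) 𝓘(ℝ, ℝ) f x)
    (hg : MDifferentiableAt 𝓘(ℝ, E) 𝓘(ℝ, ℝ) g x) (v : TangentSpace 𝓘(ℝ, E) x) :
    dirDeriv (fun y => f y * g y) x v = f x * dirDeriv g x v + g x * dirDeriv f x v :=
  congr($(mvfderiv_mul (I := 𝓘(ℝ, E)) hf hg) v)

theorem bracket_smul_right (hf : MDifferentiableAt 𝓘(ℝ, E) 𝓘(ℝ, ℝ) f x)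
    (hY : SmoothOn Y O) (hO : IsOpen O) (hx : x ∈ O) :
    bracket X (f • Y) x = dirDeriv f x (X x) • Y x + f x • bracket X Y x :=
  VectorField.mlieBracket_smul_right hf (hY.mdifferentiableAt hO hx)

theorem bracket_add_right (hY : SmoothOn Y O) (hZ : SmoothOn Z O) (hO : IsOpen O) (hx : x ∈ O) :
    bracket X (Y + Z) x = bracket X Y x + bracket X Z x :=
  VectorField.mlieBracket_add_right (hY.mdifferentiableAt hO hx) (hZ.mdifferentiableAt hO hx)

theorem bracket_congr_right (hO : IsOpen O) (hx : x ∈ O) (h : ∀ y ∈ O, Y y = Z y) :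
    bracket X Y x = bracket X Z x :=
  Filter.EventuallyEq.mlieBracket_vectorField_eq (.refl _ _)
    (Filter.eventually_of_mem (hO.mem_nhds hx) h)

theorem bracket_leibniz (hX : SmoothOn X O) (hY : SmoothOn Y O) (hZ : SmoothOn Z O)
    (hO : IsOpen O) (hx : x ∈ O) :
    bracket X (bracket Y Z) x = bracket (bracket X Y) Z x + bracket Y (bracket X Z) x :=
  haveI : IsManifold 𝓘(ℝ, E) (minSmoothness ℝ 3) M :=
    IsManifold.of_le (n := ∞) (by
      simpa using WithTop.coe_le_coe.2 (le_top : (3 : ℕ∞) ≤ ⊤))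
  have h2 : minSmoothness ℝ 2 ≤ (∞ : WithTop ℕ∞) := by
    simpa using WithTop.coe_le_coe.2 (le_top : (2 : ℕ∞) ≤ ⊤)
  VectorField.leibniz_identity_mlieBracket_apply ((hX.contMDiffAt hO hx).of_le h2)
    ((hY.contMDiffAt hO hx).of_le h2) ((hZ.contMDiffAt hO hx).of_le h2)

/-- `[X, Y] f = X (Y f) - Y (X f)`. -/
theorem dirDeriv_bracket {a b : M → ℝ} (hX : SmoothOn X O) (hY : SmoothOn Y O)
    (hW : SmoothOn W O) (hWx : W x ≠ 0) (hf : ContMDiffOn 𝓘(ℝ, E) 𝓘(ℝ, ℝ) ∞ f O)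
    (ha : ContMDiffOn 𝓘(ℝ, E) 𝓘(ℝ, ℝ) ∞ a O) (hb : ContMDiffOn 𝓘(ℝ, E) 𝓘(ℝ, ℝ) ∞ b O)
    (hXf : ∀ y ∈ O, dirDeriv f y (X y) = a y) (hYf : ∀ y ∈ O, dirDeriv f y (Y y) = b y)
    (hO : IsOpen O) (hx : x ∈ O) :
    dirDeriv f x (bracket X Y x) = dirDeriv b x (X x) - dirDeriv a x (Y x) := by
  have dd {h : M → ℝ} (hh : ContMDiffOn 𝓘(ℝ, E) 𝓘(ℝ, ℝ) ∞ h O) {y : M} (hy : y ∈ O) :=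
    hh.mdifferentiableAt_of_isOpen hO hy
  have expand {X Y : VecField E M} {a b : M → ℝ} (hY : SmoothOn Y O)
      (hb : ContMDiffOn 𝓘(ℝ, E) 𝓘(ℝ, ℝ) ∞ b O) (hXf : dirDeriv f x (X x) = a x)
      (hYf : ∀ y ∈ O, dirDeriv f y (Y y) = b y) :
      bracket X (bracket Y (f • W)) x = (dirDeriv b x (X x) • W x + b x • bracket X W x)
        + (a x • bracket Y W x + f x • bracket X (bracket Y W) x) := by
    rw [bracket_congr_right hO hx (Y := bracket Y (f • W)) (Z := b • W + f • bracket Y W)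
        fun y hy => by rw [bracket_smul_right (dd hf hy) hW hO hy, hYf y hy]; rfl,
      bracket_add_right (hW.smul hb) ((hY.bracket hW hO).smul hf) hO hx,
      bracket_smul_right (dd hb hx) hW hO hx,
      bracket_smul_right (dd hf hx) (hY.bracket hW hO) hO hx, hXf]
  -- Jacobi for X, Y, fW: after expansion, the mixed terms cancel and the f-terms cancel by Jacobi
  -- for X, Y, W. What remains is the desired scalar times W, and W is nonzero at x.
  have key := bracket_leibniz hX hY (hW.smul hf) hO hx
  rw [expand hY hb (hXf x hx) hYf, expand hX ha (hYf x hx) hXf,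
    bracket_smul_right (dd hf hx) hW hO hx, bracket_leibniz hX hY hW hO hx] at key
  have : (dirDeriv f x (bracket X Y x) - (dirDeriv b x (X x) - dirDeriv a x (Y x))) • W x = 0 := by
    refine Eq.trans ?_ (neg_eq_zero.2 (sub_eq_zero.2 key))
    module
  exact sub_eq_zero.1 ((smul_eq_zero.1 this).resolve_right hWx)

end Calculus

/-! ### Hermitian linear algebra on a single tangent space. -/

section LinearAlgebra

variable {V : Type*} [NormedAddCommGroup V] [InnerProductSpace ℝ V]
  {J A : V →L[ℝ] V} {D K : Submodule ℝ V} {ξ v w : V}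

theorem inner_J_left (hsq : ∀ v, J (J v) = -v)
    (horth : ∀ v w, inner ℝ (J v) (J w) = inner ℝ v w) (v w : V) :
    inner ℝ (J v) w = -inner ℝ v (J w) := by
  rw [← horth (J v) w, hsq, inner_neg_left]

theorem inner_J_self (hsq : ∀ v, J (J v) = -v)
    (horth : ∀ v w, inner ℝ (J v) (J w) = inner ℝ v w) (v : V) : inner ℝ (J v) v = 0 := by
  have := inner_J_left hsq horth v v
  rw [real_inner_comm] at this ⊢
  linarith

theorem J_mem_orthogonal (hsq : ∀ v, J (J v) = -v)
    (horth : ∀ v w, inner ℝ (J v) (J w) = inner ℝ v w) (hD : ∀ v ∈ D, J v ∈ D) (hv : v ∈ Dᗮ) :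
    J v ∈ Dᗮ := by
  rw [Submodule.mem_orthogonal'] at hv ⊢
  intro u hu
  rw [inner_J_left hsq horth, hv _ (hD u hu), neg_zero]

/-- A complex line is spanned by a unit vector `ξ` and `J ξ`. -/
theorem eq_of_mem_complexLine (hsq : ∀ v, J (J v) = -v)
    (horth : ∀ v w, inner ℝ (J v) (J w) = inner ℝ v w) (hD : ∀ v ∈ D, J v ∈ D)
    (hrank : Module.finrank ℝ D = 2) (hξ : ξ ∈ D) (hn : ‖ξ‖ = 1) (hv : v ∈ D) :
    v = inner ℝ ξ v • ξ + inner ℝ (J ξ) v • J ξ := by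
  have hξξ : inner ℝ ξ ξ = 1 := by rw [real_inner_self_eq_norm_sq, hn]; norm_num
  have hJJ : inner ℝ (J ξ) (J ξ) = 1 := by rw [horth, hξξ]
  have hJξ : inner ℝ (J ξ) ξ = 0 := inner_J_self hsq horth ξ
  have hξJ : inner ℝ ξ (J ξ) = 0 := by rw [real_inner_comm, hJξ]
  have hli : LinearIndependent ℝ ![ξ, J ξ] := by
    rw [LinearIndependent.pair_iff]
    intro s t h
    constructor
    · simpa only [inner_add_right, inner_smul_right, inner_zero_right, hξξ, hξJ, mul_one, mul_zero,
        add_zero] using congr(inner ℝ ξ $h)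
    · simpa only [inner_add_right, inner_smul_right, inner_zero_right, hJJ, hJξ, mul_one, mul_zero,
        zero_add] using congr(inner ℝ (J ξ) $h)
  have hle : Submodule.span ℝ (range ![ξ, J ξ]) ≤ D := by
    rw [Submodule.span_le]
    rintro _ ⟨i, rfl⟩
    fin_cases i
    exacts [hξ, hD ξ hξ]
  have : FiniteDimensional ℝ D := Module.finite_of_finrank_eq_succ hrank
  have heq : Submodule.span ℝ (range ![ξ, J ξ]) = D :=
    Submodule.eq_of_le_of_finrank_eq hle (by rw [finrank_span_eq_card hli, hrank]; rfl)
  rw [← heq, Matrix.range_cons, Matrix.range_cons, Matrix.range_empty, union_empty,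
    singleton_union, Submodule.mem_span_pair] at hv
  obtain ⟨s, t, rfl⟩ := hv
  simp only [inner_add_right, inner_smul_right, hξξ, hξJ, hJJ, hJξ, mul_one, mul_zero, add_zero,
    zero_add]

theorem starProjection_orthogonal_complexLine [FiniteDimensional ℝ V] (hsq : ∀ v, J (J v) = -v)
    (horth : ∀ v w, inner ℝ (J v) (J w) = inner ℝ v w) (hD : ∀ v ∈ D, J v ∈ D)
    (hrank : Module.finrank ℝ D = 2) (hξ : ξ ∈ D) (hn : ‖ξ‖ = 1) (v : V) :
    (Dᗮ).starProjection v = v - (inner ℝ ξ v • ξ + inner ℝ (J ξ) v • J ξ) := by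
  have hP : D.starProjection v = inner ℝ ξ v • ξ + inner ℝ (J ξ) v • J ξ := by
    rw [eq_of_mem_complexLine hsq horth hD hrank hξ hn (D.starProjection_apply_mem v),
      ← Submodule.inner_starProjection_left_eq_right, ← Submodule.inner_starProjection_left_eq_right,
      Submodule.starProjection_eq_self_iff.2 hξ, Submodule.starProjection_eq_self_iff.2 (hD ξ hξ)]
  rw [Submodule.starProjection_orthogonal', ← hP]
  rfl

theorem norm_eq_of_apply_eq_inner {f : V →L[ℝ] ℝ} {c : ℝ} (hc : 0 ≤ c) (hn : ‖ξ‖ = 1)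
    (h : ∀ v, f v = c * inner ℝ ξ v) : ‖f‖ = c := by
  have hf : f = c • innerSL ℝ ξ := ContinuousLinearMap.ext h
  rw [hf, norm_smul, innerSL_apply_norm, hn, mul_one, Real.norm_of_nonneg hc]

/-- With P the projection, the trace is ∑ g(APe, Pe) over an orthonormal basis of all of V, which is
a ∑ |Pe|² = a tr P. Only the quadratic form of A on K enters. -/
theorem trace_compression [FiniteDimensional ℝ V] {a : ℝ}
    (h : ∀ v ∈ K, inner ℝ (A v) v = a * inner ℝ v v) :
    LinearMap.trace ℝ V (K.starProjection ∘L A ∘L K.starProjection : V →L[ℝ] V).toLinearMap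
      = a * Module.finrank ℝ K := by
  have htr : LinearMap.trace ℝ V K.starProjection.toLinearMap = Module.finrank ℝ K :=
    LinearMap.IsProj.trace ⟨fun v => K.starProjection_apply_mem v,
      fun v hv => Submodule.starProjection_eq_self_iff.2 hv⟩
  rw [← htr, LinearMap.trace_eq_sum_inner _ (stdOrthonormalBasis ℝ V),
    LinearMap.trace_eq_sum_inner _ (stdOrthonormalBasis ℝ V), Finset.mul_sum]
  refine Finset.sum_congr rfl fun i _ => ?_
  set e := stdOrthonormalBasis ℝ V i
  have h1 := h _ (K.starProjection_apply_mem e)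
  have h2 : inner ℝ (K.starProjection e) (K.starProjection e) = inner ℝ e (K.starProjection e) := by
    rw [Submodule.inner_starProjection_left_eq_right,
      Submodule.starProjection_eq_self_iff.2 (K.starProjection_apply_mem e)]
  rw [h2, real_inner_comm, Submodule.inner_starProjection_left_eq_right] at h1
  exact h1

/-- A complex linear endomorphism `A` such that the symmetric parts of `A` and `J A` are multiples
of the identity is a complex multiple of the identity. -/
theorem inner_eq_of_conformal (hsq : ∀ v, J (J v) = -v)
    (horth : ∀ v w, inner ℝ (J v) (J w) = inner ℝ v w) (hJK : ∀ v ∈ K, J v ∈ K) {a b : ℝ}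
    (h1 : ∀ v ∈ K, ∀ w ∈ K, inner ℝ (A v) w + inner ℝ (A w) v = a * inner ℝ v w)
    (h2 : ∀ v ∈ K, ∀ w ∈ K, inner ℝ (J (A v)) w + inner ℝ (J (A w)) v = b * inner ℝ v w)
    (h3 : ∀ v ∈ K, ∀ w ∈ K, inner ℝ (A (J v)) w = inner ℝ (J (A v)) w)
    (hv : v ∈ K) (hw : w ∈ K) :
    inner ℝ (A v) w = 1 / 2 * a * inner ℝ v w - 1 / 2 * b * inner ℝ (J v) w := by
  have e1 := h1 v hv w hw
  -- Replacing w by Jw, and commuting A past J, turns the symmetric part of JA into the skew part of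
  -- A.
  have e2 := h2 v hv (J w) (hJK w hw)
  have e3 := h3 w hw (J v) (hJK v hv)
  have e4 := h3 (J w) (hJK w hw) v hv
  rw [horth] at e2 e3
  rw [← e4, hsq, map_neg, inner_neg_left] at e2
  rw [inner_J_left hsq horth v w]
  linarith

end LinearAlgebra

/-! ### The tensor ∇X along Dᗮ for sections X of D. -/

section RiemannianCalculus

variable {E : Type*} [NormedAddCommGroup E] [NormedSpace ℝ E] [FiniteDimensional ℝ E]
  {M : Type*} [TopologicalSpace M] [ChartedSpace E M] [IsManifold 𝓘(ℝ, E) ∞ M]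
  [RiemannianBundle (fun x : M => TangentSpace 𝓘(ℝ, E) x)]
  [IsContMDiffRiemannianBundle 𝓘(ℝ, E) ∞ E (fun x : M => TangentSpace 𝓘(ℝ, E) x)]
  {O : Set M} {X Y Z W : VecField E M} {f g : M → ℝ} {x : M} {nabla : Connection E M}
  {J : EndField E M}

theorem SmoothOn.inner (hX : SmoothOn X O) (hY : SmoothOn Y O) :
    ContMDiffOn 𝓘(ℝ, E) 𝓘(ℝ, ℝ) ∞ (fun y => inner ℝ (X y) (Y y)) O :=
  ContMDiffOn.inner_bundle (E := fun y : M => TangentSpace 𝓘(ℝ, E) y) hX hY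

theorem IsLeviCivita.dirDeriv_inner (h : IsLeviCivita nabla) (hX : SmoothOn X O)
    (hY : SmoothOn Y O) (hO : IsOpen O) (hx : x ∈ O) (v : TangentSpace 𝓘(ℝ, E) x) :
    dirDeriv (fun y => inner ℝ (X y) (Y y)) x v
      = inner ℝ (nabla X x v) (Y x) + inner ℝ (X x) (nabla Y x v) := by
  have := h.metric.mvfderiv_inner_eq (FiberBundle.extend E v) (hX.mdifferentiableAt hO hx)
    (hY.mdifferentiableAt hO hx)
  simp only [FiberBundle.extend_apply_self] at this
  exact this

theorem IsLeviCivita.bracket_eq (h : IsLeviCivita nabla) (hX : SmoothOn X O)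
    (hY : SmoothOn Y O) (hO : IsOpen O) (hx : x ∈ O) :
    bracket X Y x = nabla Y x (X x) - nabla X x (Y x) :=
  ((CovariantDerivative.torsion_eq_zero_iff _).1 h.torsion_eq_zero
    (hX.mdifferentiableAt hO hx) (hY.mdifferentiableAt hO hx)).symm

/-- For a metric torsion-free connection, the Lie derivative of g along X is twice the symmetric
part of ∇X. -/
theorem IsConformal.inner_nabla_add {D : TangentDistribution E M} {α : OneForm E M}
    (h : IsConformal D α) (hL : IsLeviCivita nabla) (hX : IsSectionOn D X O) (hO : IsOpen O)
    (hx : x ∈ O) {v w : TangentSpace 𝓘(ℝ, E) x} (hv : v ∈ (D x)ᗮ) (hw : w ∈ (D x)ᗮ) :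
    inner ℝ (nabla X x v) w + inner ℝ (nabla X x w) v = α x (X x) * inner ℝ v w := by
  obtain ⟨O', hO'O, hO', hx', Y, hY, rfl⟩ := exists_smoothOn_eq hO hx v
  obtain ⟨O'', hO''O, hO'', hx'', Z, hZ, rfl⟩ := exists_smoothOn_eq hO' hx' w
  have hX' := hX.1.mono (hO''O.trans hO'O)
  have hY' := hY.mono hO''O
  rw [← h.lie_eq O'' hO'' X Y Z ⟨hX', fun y hy => hX.2 y (hO'O (hO''O hy))⟩ hY' hZ x hx'' hv hw,
    lieMetric, hL.dirDeriv_inner hY' hZ hO'' hx'', hL.bracket_eq hX' hY' hO'' hx'',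
    hL.bracket_eq hX' hZ hO'' hx'', inner_sub_left, inner_sub_right,
    real_inner_comm (nabla X x (Z x))]
  ring

/-- As ∇J = 0 and the torsion vanishes, (L_X J)Y = J∇_Y X - ∇_{JY} X. -/
theorem IsHolomorphic.nabla_J_sub_mem {D : TangentDistribution E M} (h : IsHolomorphic J D)
    (hK : IsKahler nabla J) (hX : IsSectionOn D X O) (hO : IsOpen O)
    (hx : x ∈ O) (v : TangentSpace 𝓘(ℝ, E) x) :
    nabla X x (J x v) - J x (nabla X x v) ∈ D x := by
  obtain ⟨O', hO'O, hO', hx', Y, hY, rfl⟩ := exists_smoothOn_eq hO hx v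
  have hX' := hX.1.mono hO'O
  have := h O' hO' X Y ⟨hX', fun y hy => hX.2 y (hO'O hy)⟩ hY x hx'
  rw [hK.leviCivita.bracket_eq hX' (hY.app hK.smooth) hO' hx', hK.leviCivita.bracket_eq hX' hY hO' hx',
    hK.parallel O' hO' Y hY x hx', map_sub] at this
  rw [← neg_mem_iff]
  convert this using 1
  simp only [app]
  abel

/-- The tensor `∇V` on `Dᗮ`, for a section `V` of `D`. -/
theorem inner_nabla_eq {D : TangentDistribution E M} {α : OneForm E M} (hK : IsKahler nabla J)
    (hJ : IsComplex J D) (hα : IsConformal D α) (hhol : IsHolomorphic J D)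
    (hX : IsSectionOn D X O) (hO : IsOpen O)
    (hx : x ∈ O) {v w : TangentSpace 𝓘(ℝ, E) x} (hv : v ∈ (D x)ᗮ) (hw : w ∈ (D x)ᗮ) :
    inner ℝ (nabla X x v) w
      = 1 / 2 * α x (X x) * inner ℝ v w - 1 / 2 * α x (J x (X x)) * inner ℝ (J x v) w := by
  have hJX : IsSectionOn D (app J X) O := ⟨hX.1.app hK.smooth, fun y hy => hJ y _ (hX.2 y hy)⟩
  refine inner_eq_of_conformal (hK.sq_eq_neg x) (hK.orthogonal x) (K := (D x)ᗮ)
    (fun v => J_mem_orthogonal (hK.sq_eq_neg x) (hK.orthogonal x) (hJ x))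
    (fun v hv w hw => hα.inner_nabla_add hK.leviCivita hX hO hx hv hw)
    (fun v hv w hw => ?_) (fun v hv w hw => ?_) hv hw
  -- J∇X = ∇(JX) with JX again a section of D, so conformality applies to it too.
  · rw [← hK.parallel O hO X hX.1 x hx, ← hK.parallel O hO X hX.1 x hx]
    exact hα.inner_nabla_add hK.leviCivita hJX hO hx hv hw
  · rw [← sub_eq_zero, ← inner_sub_left]
    exact hw _ (hhol.nabla_J_sub_mem hK hX hO hx v)

/-- The α(JX) term of ∇X is skew and drops out of the trace. -/
theorem divPerp_eq {D : TangentDistribution E M} {α : OneForm E M} (hK : IsKahler nabla J)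
    (hJ : IsComplex J D) (hα : IsConformal D α) (hhol : IsHolomorphic J D)
    (hX : IsSectionOn D X O) (hO : IsOpen O) (hx : x ∈ O) :
    divPerp nabla D X x = 1 / 2 * α x (X x) * Module.finrank ℝ (D x)ᗮ := by
  have : FiniteDimensional ℝ (TangentSpace 𝓘(ℝ, E) x) := inferInstanceAs (FiniteDimensional ℝ E)
  refine trace_compression fun v hv => ?_
  rw [inner_nabla_eq hK hJ hα hhol hX hO hx hv hv, inner_J_self (hK.sq_eq_neg x) (hK.orthogonal x)]
  ring

end RiemannianCalculus

/-! ### Consequences of dα = 0 for the principal field, up to ∇_ξ ξ = 0. -/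

section PrincipalField

variable {E : Type*} [NormedAddCommGroup E] [NormedSpace ℝ E] [FiniteDimensional ℝ E]
  {M : Type*} [TopologicalSpace M] [ChartedSpace E M] [IsManifold 𝓘(ℝ, E) ∞ M]
  [RiemannianBundle (fun x : M => TangentSpace 𝓘(ℝ, E) x)]
  [IsContMDiffRiemannianBundle 𝓘(ℝ, E) ∞ E (fun x : M => TangentSpace 𝓘(ℝ, E) x)]

theorem isOpen_nonvanishing {α : OneForm E M} (hα : SmoothForm α) : IsOpen (nonvanishing α) := by
  rw [isOpen_iff_mem_nhds]
  intro x hx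
  obtain ⟨v, hv⟩ : ∃ v, α x v ≠ 0 := by
    by_contra! h
    exact hx (ContinuousLinearMap.ext h)
  obtain ⟨O, -, hO, hxO, X, hX, rfl⟩ := exists_smoothOn_eq isOpen_univ (mem_univ x) v
  have hc : ContinuousAt (fun y => α y (X y)) x :=
    (hα.contMDiffOn_apply hX).continuousOn.continuousAt (hO.mem_nhds hxO)
  filter_upwards [hc.eventually_ne hv] with y hy h0
  exact hy (by rw [h0]; rfl)

/-- A Kähler manifold of real dimension greater than two with a complex, homothetic, totally
geodesic and holomorphic foliation by surfaces, together with its principal field. -/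
structure IsPrincipalFoliation (nabla : Connection E M) (J : EndField E M)
    (D : TangentDistribution E M) (α : OneForm E M) (ξ : VecField E M) : Prop where
  two_lt : 2 < Module.finrank ℝ E
  kahler : IsKahler nabla J
  foliation : IsFoliation 2 D
  complex : IsComplex J D
  homothetic : IsHomothetic D α
  geodesic : IsTotallyGeodesic nabla D
  holomorphic : IsHolomorphic J D
  principal : IsPrincipalFieldOn nabla J D (nonvanishing α) ξ

theorem projPerp_mem {D : TangentDistribution E M} {x : M} (v : TangentSpace 𝓘(ℝ, E) x) :
    projPerp D x v ∈ (D x)ᗮ :=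
  have : FiniteDimensional ℝ (TangentSpace 𝓘(ℝ, E) x) := inferInstanceAs (FiniteDimensional ℝ E)
  (D x)ᗮ.starProjection_apply_mem v

theorem projPerp_of_mem_orthogonal {D : TangentDistribution E M} {x : M}
    {v : TangentSpace 𝓘(ℝ, E) x} (hv : v ∈ (D x)ᗮ) : projPerp D x v = v :=
  have : FiniteDimensional ℝ (TangentSpace 𝓘(ℝ, E) x) := inferInstanceAs (FiniteDimensional ℝ E)
  Submodule.starProjection_eq_self_iff.2 hv

theorem projPerp_of_mem {D : TangentDistribution E M} {x : M}
    {v : TangentSpace 𝓘(ℝ, E) x} (hv : v ∈ D x) : projPerp D x v = 0 :=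
  have : FiniteDimensional ℝ (TangentSpace 𝓘(ℝ, E) x) := inferInstanceAs (FiniteDimensional ℝ E)
  (Submodule.starProjection_apply_eq_zero_iff _).2 (Submodule.le_orthogonal_orthogonal _ hv)

theorem inner_projPerp_left {D : TangentDistribution E M} {x : M}
    (v w : TangentSpace 𝓘(ℝ, E) x) : inner ℝ (projPerp D x v) w = inner ℝ v (projPerp D x w) :=
  have : FiniteDimensional ℝ (TangentSpace 𝓘(ℝ, E) x) := inferInstanceAs (FiniteDimensional ℝ E)
  Submodule.inner_starProjection_left_eq_right _ v w

theorem metricPerp_eq {D : TangentDistribution E M} {x : M}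
    (v w : TangentSpace 𝓘(ℝ, E) x) : metricPerp D x v w = inner ℝ (projPerp D x v) w := by
  rw [metricPerp, inner_projPerp_left, projPerp_of_mem_orthogonal (projPerp_mem w),
    ← inner_projPerp_left]

theorem IsLeviCivita.inner_nabla_of_inner_eq_const {nabla : Connection E M}
    (h : IsLeviCivita nabla) {O : Set M} {X Y : VecField E M} {a : ℝ} {x : M}
    (hX : SmoothOn X O) (hY : SmoothOn Y O) (hO : IsOpen O) (hx : x ∈ O)
    (hXY : ∀ y ∈ O, inner ℝ (X y) (Y y) = a) (v : TangentSpace 𝓘(ℝ, E) x) :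
    inner ℝ (nabla X x v) (Y x) = -inner ℝ (X x) (nabla Y x v) := by
  have := h.dirDeriv_inner hX hY hO hx v
  rw [dirDeriv_congr hO hx hXY, dirDeriv_const] at this
  linarith

namespace IsPrincipalFoliation

variable {nabla : Connection E M} {J : EndField E M} {D : TangentDistribution E M}
  {α : OneForm E M} {ξ : VecField E M} {x : M} {O : Set M} {X Y Z : VecField E M}
  (H : IsPrincipalFoliation nabla J D α ξ)

include H

theorem isOpen : IsOpen (nonvanishing α) := isOpen_nonvanishing H.homothetic.1.smooth

theorem smoothOn : SmoothOn ξ (nonvanishing α) := H.principal.isSection.1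

theorem isSectionOn_app : IsSectionOn D (app J ξ) (nonvanishing α) :=
  ⟨H.smoothOn.app H.kahler.smooth, fun y hy => H.complex y _ (H.principal.isSection.2 y hy)⟩

/-- The dimension bound enters here: divergences along Dᗮ determine α only if Dᗮ is nonzero. -/
theorem finrank_orthogonal_pos : 0 < Module.finrank ℝ (D x)ᗮ := by
  have : FiniteDimensional ℝ (TangentSpace 𝓘(ℝ, E) x) := inferInstanceAs (FiniteDimensional ℝ E)
  have h1 := (D x).finrank_add_finrank_orthogonal
  have h2 : Module.finrank ℝ (TangentSpace 𝓘(ℝ, E) x) = Module.finrank ℝ E := rfl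
  have h3 := H.two_lt
  have h4 := H.foliation.finrank_eq x
  omega

theorem inner_J_left (v w : TangentSpace 𝓘(ℝ, E) x) :
    inner ℝ (J x v) w = -inner ℝ v (J x w) :=
  HomotheticFoliation.inner_J_left (H.kahler.sq_eq_neg x) (H.kahler.orthogonal x) v w

theorem inner_J_self (v : TangentSpace 𝓘(ℝ, E) x) : inner ℝ (J x v) v = 0 :=
  HomotheticFoliation.inner_J_self (H.kahler.sq_eq_neg x) (H.kahler.orthogonal x) v

theorem J_mem_orthogonal {v : TangentSpace 𝓘(ℝ, E) x} (hv : v ∈ (D x)ᗮ) : J x v ∈ (D x)ᗮ :=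
  HomotheticFoliation.J_mem_orthogonal (H.kahler.sq_eq_neg x) (H.kahler.orthogonal x)
    (H.complex x) hv

theorem inner_self_eq_one (hx : x ∈ nonvanishing α) : inner ℝ (ξ x) (ξ x) = 1 := by
  rw [real_inner_self_eq_norm_sq, H.principal.norm_eq_one x hx]
  norm_num

theorem projPerp_eq (hx : x ∈ nonvanishing α) (v : TangentSpace 𝓘(ℝ, E) x) :
    projPerp D x v = v - (inner ℝ (ξ x) v • ξ x + inner ℝ (J x (ξ x)) v • J x (ξ x)) :=
  have : FiniteDimensional ℝ (TangentSpace 𝓘(ℝ, E) x) := inferInstanceAs (FiniteDimensional ℝ E)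
  starProjection_orthogonal_complexLine (H.kahler.sq_eq_neg x) (H.kahler.orthogonal x)
    (H.complex x) (H.foliation.finrank_eq x) (H.principal.isSection.2 x hx)
    (H.principal.norm_eq_one x hx) v

theorem eq_add (hx : x ∈ nonvanishing α) (v : TangentSpace 𝓘(ℝ, E) x) :
    v = projPerp D x v + (inner ℝ (ξ x) v • ξ x + inner ℝ (J x (ξ x)) v • J x (ξ x)) := by
  rw [H.projPerp_eq hx, sub_add_cancel]

theorem inner_of_mem_orthogonal (hx : x ∈ nonvanishing α) {v : TangentSpace 𝓘(ℝ, E) x}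
    (hv : v ∈ (D x)ᗮ) : inner ℝ (ξ x) v = 0 ∧ inner ℝ (J x (ξ x)) v = 0 :=
  ⟨hv _ (H.principal.isSection.2 x hx), hv _ (H.isSectionOn_app.2 x hx)⟩

theorem alpha_J_eq_zero (hx : x ∈ nonvanishing α) : α x (J x (ξ x)) = 0 := by
  have h := divPerp_eq H.kahler H.complex H.homothetic.1 H.holomorphic H.isSectionOn_app H.isOpen hx
  rw [H.principal.div_J_eq_zero x hx] at h
  have h1 : (Module.finrank ℝ (D x)ᗮ : ℝ) ≠ 0 := by exact_mod_cast H.finrank_orthogonal_pos.ne'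
  have h2 : (1 / 2 : ℝ) * α x (J x (ξ x)) = 0 := (mul_eq_zero.1 h.symm).resolve_right h1
  linarith

theorem alpha_eq (hx : x ∈ nonvanishing α) (v : TangentSpace 𝓘(ℝ, E) x) :
    α x v = α x (ξ x) * inner ℝ (ξ x) v := by
  conv_lhs => rw [H.eq_add hx v]
  rw [map_add, map_add, map_smul, map_smul, H.alpha_J_eq_zero hx,
    H.homothetic.1.vanish x _ (projPerp_mem v), smul_eq_mul, smul_eq_mul]
  ring

/-- The choice div ξ = κ ≥ 0 fixes the sign, and α(ξ) = 0 would force α = 0 at x. -/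
theorem alpha_pos (hx : x ∈ nonvanishing α) : 0 < α x (ξ x) := by
  have h := divPerp_eq H.kahler H.complex H.homothetic.1 H.holomorphic H.principal.isSection
    H.isOpen hx
  have h0 : 0 ≤ divPerp nabla D ξ x := by
    rw [H.principal.div_eq x hx]
    exact Real.sqrt_nonneg _
  rw [h] at h0
  have h1 : (0 : ℝ) < Module.finrank ℝ (D x)ᗮ := by exact_mod_cast H.finrank_orthogonal_pos
  have h2 : 0 ≤ α x (ξ x) := by
    have := nonneg_of_mul_nonneg_left h0 h1
    linarith
  refine lt_of_le_of_ne h2 fun h3 => hx (ContinuousLinearMap.ext fun v => ?_)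
  rw [H.alpha_eq hx, ← h3, zero_mul]
  rfl

theorem norm_alpha (hx : x ∈ nonvanishing α) : ‖α x‖ = α x (ξ x) :=
  norm_eq_of_apply_eq_inner (H.alpha_pos hx).le (H.principal.norm_eq_one x hx) (H.alpha_eq hx)

theorem contMDiffOn_alpha :
    ContMDiffOn 𝓘(ℝ, E) 𝓘(ℝ, ℝ) ∞ (fun y => α y (ξ y)) (nonvanishing α) :=
  H.homothetic.1.smooth.contMDiffOn_apply H.smoothOn

theorem inner_nabla_self (hx : x ∈ nonvanishing α) (v : TangentSpace 𝓘(ℝ, E) x) :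
    inner ℝ (ξ x) (nabla ξ x v) = 0 := by
  have := H.kahler.leviCivita.inner_nabla_of_inner_eq_const H.smoothOn H.smoothOn H.isOpen hx
    (fun y hy => H.inner_self_eq_one hy) v
  rw [real_inner_comm] at this
  linarith

theorem nabla_mem (hx : x ∈ nonvanishing α) {v : TangentSpace 𝓘(ℝ, E) x} (a b : ℝ)
    (hv : v = a • ξ x + b • J x (ξ x)) : nabla ξ x v ∈ D x := by
  rw [hv, map_add, map_smul, map_smul]
  exact add_mem
    (Submodule.smul_mem _ _ (H.geodesic _ H.isOpen _ _ H.principal.isSection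
      H.principal.isSection x hx))
    (Submodule.smul_mem _ _ (H.geodesic _ H.isOpen _ _ H.isSectionOn_app
      H.principal.isSection x hx))

theorem projPerp_nabla (hx : x ∈ nonvanishing α) (v : TangentSpace 𝓘(ℝ, E) x) :
    projPerp D x (nabla ξ x v) = (1 / 2 * α x (ξ x)) • projPerp D x v := by
  conv_lhs => rw [H.eq_add hx v]
  rw [map_add, map_add, projPerp_of_mem (H.nabla_mem hx _ _ rfl), add_zero, ← sub_eq_zero]
  set z := projPerp D x (nabla ξ x (projPerp D x v)) - (1 / 2 * α x (ξ x)) • projPerp D x v with hz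
  have hzm : z ∈ (D x)ᗮ :=
    sub_mem (projPerp_mem _) (Submodule.smul_mem _ _ (projPerp_mem _))
  rw [← inner_self_eq_zero (𝕜 := ℝ)]
  conv_lhs => rw [hz]
  rw [inner_sub_left, inner_projPerp_left, projPerp_of_mem_orthogonal hzm,
    inner_nabla_eq H.kahler H.complex H.homothetic.1 H.holomorphic H.principal.isSection H.isOpen hx
      (projPerp_mem v) hzm, H.alpha_J_eq_zero hx, inner_smul_left, RCLike.conj_to_real]
  ring

theorem nabla_eq_add (hx : x ∈ nonvanishing α) (v : TangentSpace 𝓘(ℝ, E) x) :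
    nabla ξ x v = (1 / 2 * α x (ξ x)) • projPerp D x v
      + inner ℝ (J x (ξ x)) (nabla ξ x v) • J x (ξ x) := by
  conv_lhs => rw [H.eq_add hx (nabla ξ x v)]
  rw [H.projPerp_nabla hx, H.inner_nabla_self hx, zero_smul, zero_add]

/-- The closedness of `α = |α| ξ♭`. -/
theorem closed (hx : x ∈ nonvanishing α) (v w : TangentSpace 𝓘(ℝ, E) x) :
    dirDeriv (fun y => α y (ξ y)) x v * inner ℝ (ξ x) w
      - dirDeriv (fun y => α y (ξ y)) x w * inner ℝ (ξ x) v
      + α x (ξ x) * (inner ℝ (nabla ξ x v) w - inner ℝ (nabla ξ x w) v) = 0 := by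
  obtain ⟨O', hO'U, hO', hx', X, hX', rfl⟩ := exists_smoothOn_eq H.isOpen hx v
  obtain ⟨O, hOO', hO, hxO, Y, hY, rfl⟩ := exists_smoothOn_eq hO' hx' w
  have hX := hX'.mono hOO'
  have hOU := hOO'.trans hO'U
  have hL := H.kahler.leviCivita
  have deriv {Z : VecField E M} (hZ : SmoothOn Z O) (u : TangentSpace 𝓘(ℝ, E) x) :
      dirDeriv (fun y => α y (Z y)) x u = α x (ξ x) * (inner ℝ (nabla ξ x u) (Z x)
        + inner ℝ (ξ x) (nabla Z x u)) + inner ℝ (ξ x) (Z x)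
          * dirDeriv (fun y => α y (ξ y)) x u := by
    have hξ := H.smoothOn.mono hOU
    rw [dirDeriv_congr hO hxO (fun y hy => H.alpha_eq (hOU hy) (Z y)),
      dirDeriv_mul (H.contMDiffOn_alpha.mdifferentiableAt_of_isOpen H.isOpen hx)
        ((hξ.inner hZ).mdifferentiableAt_of_isOpen hO hxO),
      hL.dirDeriv_inner hξ hZ hO hxO]
  have key := H.homothetic.2 O hO (subset_univ _) X Y hX hY x hxO
  rw [extDerivForm, deriv hY, deriv hX, H.alpha_eq hx (bracket X Y x),
    hL.bracket_eq hX hY hO hxO, inner_sub_right] at key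
  linarith

theorem inner_self_J (v : TangentSpace 𝓘(ℝ, E) x) : inner ℝ v (J x v) = 0 := by
  rw [real_inner_comm, H.inner_J_self]

theorem inner_J_J (hx : x ∈ nonvanishing α) : inner ℝ (J x (ξ x)) (J x (ξ x)) = 1 := by
  rw [H.kahler.orthogonal, H.inner_self_eq_one hx]

/-- Closedness on the pair (v, Jξ): both η-terms vanish, and ∇_{Jξ} ξ is tangent to the totally
geodesic leaf. -/
theorem inner_J_nabla_of_mem_orthogonal (hx : x ∈ nonvanishing α) {v : TangentSpace 𝓘(ℝ, E) x}
    (hv : v ∈ (D x)ᗮ) : inner ℝ (J x (ξ x)) (nabla ξ x v) = 0 := by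
  have h := H.closed hx v (J x (ξ x))
  rw [H.inner_self_J, (H.inner_of_mem_orthogonal hx hv).1,
    real_inner_comm v (nabla ξ x (J x (ξ x))),
    Submodule.inner_left_of_mem_orthogonal (H.nabla_mem hx 0 1 (by simp)) hv,
    real_inner_comm] at h
  have : α x (ξ x) * inner ℝ (J x (ξ x)) (nabla ξ x v) = 0 := by linarith
  exact (mul_eq_zero.1 this).resolve_left (H.alpha_pos hx).ne'

theorem dirDeriv_alpha_of_mem_orthogonal (hx : x ∈ nonvanishing α) {v : TangentSpace 𝓘(ℝ, E) x}
    (hv : v ∈ (D x)ᗮ) : dirDeriv (fun y => α y (ξ y)) x v = 0 := by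
  have h := H.closed hx v (ξ x)
  rw [H.inner_self_eq_one hx, (H.inner_of_mem_orthogonal hx hv).1,
    real_inner_comm v (nabla ξ x (ξ x)),
    Submodule.inner_left_of_mem_orthogonal (H.nabla_mem hx 1 0 (by simp)) hv,
    real_inner_comm, H.inner_nabla_self hx] at h
  linarith

theorem dirDeriv_alpha_J (hx : x ∈ nonvanishing α) :
    dirDeriv (fun y => α y (ξ y)) x (J x (ξ x))
      = α x (ξ x) * inner ℝ (J x (ξ x)) (nabla ξ x (ξ x)) := by
  have h := H.closed hx (J x (ξ x)) (ξ x)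
  rw [H.inner_self_eq_one hx, H.inner_self_J,
    real_inner_comm _ (nabla ξ x (J x (ξ x))), H.inner_nabla_self hx,
    real_inner_comm _ (nabla ξ x (ξ x))] at h
  linarith

/-- Smooth nonvanishing sections of the orthogonal complement of `D`. -/
theorem exists_section_orthogonal (hx : x ∈ nonvanishing α) :
    ∃ O ⊆ nonvanishing α, IsOpen O ∧ x ∈ O ∧ ∃ Y : VecField E M, SmoothOn Y O ∧
      (∀ y ∈ O, Y y ∈ (D y)ᗮ) ∧ Y x ≠ 0 := by
  have : Nontrivial (D x)ᗮ := Module.nontrivial_of_finrank_pos (R := ℝ) H.finrank_orthogonal_pos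
  obtain ⟨⟨v, hv⟩, hv0⟩ := exists_ne (0 : (D x)ᗮ)
  obtain ⟨O, hOU, hO, hxO, X, hX, rfl⟩ := exists_smoothOn_eq H.isOpen hx v
  have hξ := H.smoothOn.mono hOU
  have hJξ := H.isSectionOn_app.1.mono hOU
  refine ⟨O, hOU, hO, hxO, fun y => projPerp D y (X y), ?_, fun y _ => projPerp_mem _, ?_⟩
  · exact (hX.sub ((hξ.smul (hξ.inner hX)).add (hJξ.smul (hJξ.inner hX)))).congr
      fun y hy => H.projPerp_eq (hOU hy) _
  · dsimp only
    rw [projPerp_of_mem_orthogonal hv]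
    simpa using hv0

/-- Differentiating g(ξ, Z) = 0 and g(Jξ, Z) = 0 along Y expresses the D-part of ∇_Y Z through ∇ξ.
Its ξ-component is symmetric in Y, Z and cancels in the bracket; its Jξ-component is skew and
doubles. -/
theorem inner_bracket_orthogonal (hOU : O ⊆ nonvanishing α) (hO : IsOpen O) (hx : x ∈ O)
    (hY : SmoothOn Y O) (hZ : SmoothOn Z O) (hYp : ∀ y ∈ O, Y y ∈ (D y)ᗮ)
    (hZp : ∀ y ∈ O, Z y ∈ (D y)ᗮ) :
    inner ℝ (ξ x) (bracket Y Z x) = 0 ∧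
      inner ℝ (J x (ξ x)) (bracket Y Z x) = -(α x (ξ x) * inner ℝ (J x (Y x)) (Z x)) := by
  have hL := H.kahler.leviCivita
  have hξ := H.smoothOn.mono hOU
  have hJξ := H.isSectionOn_app.1.mono hOU
  have nab {v : TangentSpace 𝓘(ℝ, E) x} (hv : v ∈ (D x)ᗮ) :
      nabla ξ x v = (1 / 2 * α x (ξ x)) • v := by
    rw [H.nabla_eq_add (hOU hx), H.inner_J_nabla_of_mem_orthogonal (hOU hx) hv,
      projPerp_of_mem_orthogonal hv, zero_smul, add_zero]
  have h1 {Z : VecField E M} (hZ : SmoothOn Z O) (hZp : ∀ y ∈ O, Z y ∈ (D y)ᗮ)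
      {v : TangentSpace 𝓘(ℝ, E) x} (hv : v ∈ (D x)ᗮ) :
      inner ℝ (ξ x) (nabla Z x v) = -(1 / 2 * α x (ξ x) * inner ℝ v (Z x)) := by
    have := hL.inner_nabla_of_inner_eq_const hξ hZ hO hx
      (fun y hy => (H.inner_of_mem_orthogonal (hOU hy) (hZp y hy)).1) v
    rw [nab hv, inner_smul_left, RCLike.conj_to_real] at this
    linarith
  have h2 {Z : VecField E M} (hZ : SmoothOn Z O) (hZp : ∀ y ∈ O, Z y ∈ (D y)ᗮ)
      {v : TangentSpace 𝓘(ℝ, E) x} (hv : v ∈ (D x)ᗮ) :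
      inner ℝ (J x (ξ x)) (nabla Z x v) = -(1 / 2 * α x (ξ x) * inner ℝ (J x v) (Z x)) := by
    have := hL.inner_nabla_of_inner_eq_const hJξ hZ hO hx
      (fun y hy => (H.inner_of_mem_orthogonal (hOU hy) (hZp y hy)).2) v
    rw [H.kahler.parallel O hO ξ hξ x hx, nab hv, map_smul, inner_smul_left,
      RCLike.conj_to_real] at this
    change _ = -inner ℝ (J x (ξ x)) _ at this
    linarith
  rw [hL.bracket_eq hY hZ hO hx, inner_sub_right, inner_sub_right, h1 hZ hZp (hYp x hx),
    h1 hY hYp (hZp x hx), h2 hZ hZp (hYp x hx), h2 hY hYp (hZp x hx), H.inner_J_left (Z x),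
    real_inner_comm (J x (Y x)), real_inner_comm (Z x) (Y x)]
  constructor <;> ring

theorem dirDeriv_alpha_J_eq_zero (hx : x ∈ nonvanishing α) :
    dirDeriv (fun y => α y (ξ y)) x (J x (ξ x)) = 0 := by
  obtain ⟨O, hOU, hO, hxO, Y, hY, hYp, hY0⟩ := H.exists_section_orthogonal hx
  have hJY := hY.app H.kahler.smooth
  have hJYp : ∀ y ∈ O, app J Y y ∈ (D y)ᗮ := fun y hy => H.J_mem_orthogonal (hYp y hy)
  -- c is constant along Y and JY, hence along [Y, JY]. The second Y is the auxiliary field that is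
  -- nonzero at x.
  have hb := dirDeriv_bracket (a := fun _ => 0) (b := fun _ => 0) hY hJY
    hY hY0 (H.contMDiffOn_alpha.mono hOU) contMDiffOn_const contMDiffOn_const
    (fun y hy => H.dirDeriv_alpha_of_mem_orthogonal (hOU hy) (hYp y hy))
    (fun y hy => H.dirDeriv_alpha_of_mem_orthogonal (hOU hy) (hJYp y hy)) hO hxO
  obtain ⟨h1, h2⟩ := H.inner_bracket_orthogonal hOU hO hxO hY hJY hYp hJYp
  rw [dirDeriv_const, dirDeriv_const, H.eq_add hx (bracket Y (app J Y) x), dirDeriv_add_vec,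
    H.dirDeriv_alpha_of_mem_orthogonal hx (projPerp_mem _), h1, h2, zero_smul, zero_add, zero_add,
    dirDeriv_smul_vec, app, H.kahler.orthogonal, sub_zero] at hb
  have hY1 : inner ℝ (Y x) (Y x) ≠ 0 := inner_self_ne_zero.2 hY0
  exact (mul_eq_zero.1 hb).resolve_left (neg_ne_zero.2 (mul_ne_zero (H.alpha_pos hx).ne' hY1))

theorem nabla_self (hx : x ∈ nonvanishing α) : nabla ξ x (ξ x) = 0 := by
  have h := H.dirDeriv_alpha_J hx
  rw [H.dirDeriv_alpha_J_eq_zero hx] at h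
  rw [H.nabla_eq_add hx, (mul_eq_zero.1 h.symm).resolve_left (H.alpha_pos hx).ne',
    projPerp_of_mem (H.principal.isSection.2 x hx), smul_zero, zero_smul, add_zero]

end IsPrincipalFoliation

end PrincipalField

/-! ### The function p, the full formula for ∇ξ, and the derivatives of |α| and p. -/

section StructureEquations

variable {E : Type*} [NormedAddCommGroup E] [NormedSpace ℝ E] [FiniteDimensional ℝ E]
  {M : Type*} [TopologicalSpace M] [ChartedSpace E M] [IsManifold 𝓘(ℝ, E) ∞ M]
  [RiemannianBundle (fun x : M => TangentSpace 𝓘(ℝ, E) x)]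
  [IsContMDiffRiemannianBundle 𝓘(ℝ, E) ∞ E (fun x : M => TangentSpace 𝓘(ℝ, E) x)]

/-- The function `g(Jξ, [ξ, Jξ])`; for a principal field this is the function `p` such that
`∇_{Jξ} Jξ = p ξ`. -/
noncomputable def leafCurvature (J : EndField E M) (ξ : VecField E M) (x : M) : ℝ :=
  inner ℝ (J x (ξ x)) (bracket ξ (app J ξ) x)

namespace IsPrincipalFoliation

variable {nabla : Connection E M} {J : EndField E M} {D : TangentDistribution E M}
  {α : OneForm E M} {ξ : VecField E M} {x : M} {O : Set M} {X Y Z : VecField E M}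
  (H : IsPrincipalFoliation nabla J D α ξ)

include H

/-- Defining p by a bracket makes its smoothness immediate. -/
theorem contMDiffOn_leafCurvature :
    ContMDiffOn 𝓘(ℝ, E) 𝓘(ℝ, ℝ) ∞ (leafCurvature J ξ) (nonvanishing α) :=
  H.isSectionOn_app.1.inner (H.smoothOn.bracket H.isSectionOn_app.1 H.isOpen)

theorem leafCurvature_eq (hx : x ∈ nonvanishing α) :
    inner ℝ (J x (ξ x)) (nabla ξ x (J x (ξ x))) = -leafCurvature J ξ x := by
  rw [leafCurvature, H.kahler.leviCivita.bracket_eq H.smoothOn H.isSectionOn_app.1 H.isOpen hx,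
    H.kahler.parallel _ H.isOpen _ H.smoothOn x hx, H.nabla_self hx, map_zero, zero_sub,
    inner_neg_right, neg_neg]
  rfl

theorem nabla_eq (hx : x ∈ nonvanishing α) (v : TangentSpace 𝓘(ℝ, E) x) :
    nabla ξ x v = (1 / 2 * α x (ξ x)) • projPerp D x v
      - (leafCurvature J ξ x * inner ℝ (J x (ξ x)) v) • J x (ξ x) := by
  have : inner ℝ (J x (ξ x)) (nabla ξ x v) = -(leafCurvature J ξ x * inner ℝ (J x (ξ x)) v) := by
    conv_lhs => rw [H.eq_add hx v]
    rw [map_add, map_add, map_smul, map_smul, H.nabla_self hx, smul_zero, zero_add,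
      inner_add_right, inner_smul_right, H.leafCurvature_eq hx,
      H.inner_J_nabla_of_mem_orthogonal hx (projPerp_mem v)]
    ring
  rw [H.nabla_eq_add hx, this, neg_smul, ← sub_eq_add_neg]

theorem inner_nabla (hx : x ∈ nonvanishing α) (v w : TangentSpace 𝓘(ℝ, E) x) :
    inner ℝ (nabla ξ x v) w = 1 / 2 * α x (ξ x) * metricPerp D x v w
      - leafCurvature J ξ x * inner ℝ (J x (ξ x)) v * inner ℝ (J x (ξ x)) w := by
  rw [H.nabla_eq hx, inner_sub_left, inner_smul_left, inner_smul_left, metricPerp_eq,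
    RCLike.conj_to_real, RCLike.conj_to_real]

theorem inner_nabla_comm (hx : x ∈ nonvanishing α) (v w : TangentSpace 𝓘(ℝ, E) x) :
    inner ℝ (nabla ξ x v) w = inner ℝ (nabla ξ x w) v := by
  rw [H.inner_nabla hx, H.inner_nabla hx, metricPerp, metricPerp,
    real_inner_comm (projPerp D x w)]
  ring

theorem projPerp_J (hx : x ∈ nonvanishing α) : projPerp D x (J x (ξ x)) = 0 :=
  projPerp_of_mem (H.isSectionOn_app.2 x hx)

theorem nabla_J (hx : x ∈ nonvanishing α) :
    nabla (app J ξ) x (app J ξ x) = leafCurvature J ξ x • ξ x := by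
  rw [H.kahler.parallel _ H.isOpen _ H.smoothOn x hx, app, H.nabla_eq hx,
    H.projPerp_J hx, H.inner_J_J hx, map_sub, map_smul, map_smul,
    H.kahler.sq_eq_neg, map_zero]
  module

theorem mem_orthogonal (hx : x ∈ nonvanishing α) {v : TangentSpace 𝓘(ℝ, E) x}
    (h1 : inner ℝ (ξ x) v = 0) (h2 : inner ℝ (J x (ξ x)) v = 0) : v ∈ (D x)ᗮ := by
  rw [H.eq_add hx v, h1, h2, zero_smul, zero_smul, add_zero, add_zero]
  exact projPerp_mem v

theorem bracket_self_eq (hOU : O ⊆ nonvanishing α) (hO : IsOpen O) (hx : x ∈ O)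
    (hY : SmoothOn Y O) (hYp : ∀ y ∈ O, Y y ∈ (D y)ᗮ) :
    bracket ξ Y x = nabla Y x (ξ x) - (1 / 2 * α x (ξ x)) • Y x := by
  rw [H.kahler.leviCivita.bracket_eq (H.smoothOn.mono hOU) hY hO hx, H.nabla_eq (hOU hx),
    projPerp_of_mem_orthogonal (hYp x hx), (H.inner_of_mem_orthogonal (hOU hx) (hYp x hx)).2,
    mul_zero, zero_smul, sub_zero]

/-- Both ξ and Jξ are parallel along ξ, so ∇_ξ preserves Dᗮ. This lets `inner_bracket_orthogonal`
apply to the iterated brackets in the Jacobi identity. -/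
theorem bracket_self_mem (hOU : O ⊆ nonvanishing α) (hO : IsOpen O) (hx : x ∈ O)
    (hY : SmoothOn Y O) (hYp : ∀ y ∈ O, Y y ∈ (D y)ᗮ) : bracket ξ Y x ∈ (D x)ᗮ := by
  have hξ := H.smoothOn.mono hOU
  have hL := H.kahler.leviCivita
  have h1 := hL.inner_nabla_of_inner_eq_const hξ hY hO hx
    (fun y hy => (H.inner_of_mem_orthogonal (hOU hy) (hYp y hy)).1) (ξ x)
  have h2 := hL.inner_nabla_of_inner_eq_const (H.isSectionOn_app.1.mono hOU) hY hO hx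
    (fun y hy => (H.inner_of_mem_orthogonal (hOU hy) (hYp y hy)).2) (ξ x)
  rw [H.nabla_self (hOU hx), inner_zero_left] at h1
  rw [H.kahler.parallel O hO ξ hξ x hx, H.nabla_self (hOU hx), map_zero, inner_zero_left] at h2
  rw [H.bracket_self_eq hOU hO hx hY hYp]
  exact sub_mem (H.mem_orthogonal (hOU hx) (by linarith) (neg_eq_zero.1 h2.symm))
    (Submodule.smul_mem _ _ (hYp x hx))

/-- This is L_ξ(Jη) = -p Jη. -/
theorem inner_J_bracket_self (hOU : O ⊆ nonvanishing α) (hO : IsOpen O) (hx : x ∈ O)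
    (hY : SmoothOn Y O) :
    inner ℝ (J x (ξ x)) (bracket ξ Y x)
      = dirDeriv (fun y => inner ℝ (J y (ξ y)) (Y y)) x (ξ x)
        + leafCurvature J ξ x * inner ℝ (J x (ξ x)) (Y x) := by
  have hξ := H.smoothOn.mono hOU
  have hL := H.kahler.leviCivita
  have h := hL.dirDeriv_inner (H.isSectionOn_app.1.mono hOU) hY hO hx (ξ x)
  rw [H.kahler.parallel O hO ξ hξ x hx, H.nabla_self (hOU hx), map_zero, inner_zero_left,
    zero_add] at h
  rw [hL.bracket_eq hξ hY hO hx, inner_sub_right, real_inner_comm (nabla ξ x (Y x)),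
    H.inner_nabla (hOU hx), metricPerp_eq, inner_projPerp_left,
    H.projPerp_J (hOU hx), H.inner_J_J (hOU hx), inner_zero_right]
  change inner ℝ (app J ξ x) _ - _ = dirDeriv (fun y => inner ℝ (app J ξ y) (Y y)) x (ξ x) + _
  rw [h]
  ring

theorem dirDeriv_alpha_self (hx : x ∈ nonvanishing α) :
    dirDeriv (fun y => α y (ξ y)) x (ξ x)
      = -(α x (ξ x) * (α x (ξ x) + leafCurvature J ξ x)) := by
  obtain ⟨O, hOU, hO, hxO, Y, hY, hYp, hY0⟩ := H.exists_section_orthogonal hx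
  have hξ := H.smoothOn.mono hOU
  have hJY := hY.app H.kahler.smooth
  have hJYp : ∀ y ∈ O, app J Y y ∈ (D y)ᗮ := fun y hy => H.J_mem_orthogonal (hYp y hy)
  -- In the Jξ-component, the left side contains ξ(c|Y|²) and each term on the right contains c
  -- g(∇_ξ Y, Y). These derivatives of Y cancel, leaving |Y|² times the claim.
  have jac := bracket_leibniz hξ hY hJY hO hxO
  have e1 : inner ℝ (J x (ξ x)) (bracket ξ (bracket Y (app J Y)) x)
      = -(α x (ξ x) * (2 * inner ℝ (nabla Y x (ξ x)) (Y x))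
        + inner ℝ (Y x) (Y x) * dirDeriv (fun y => α y (ξ y)) x (ξ x))
        - leafCurvature J ξ x * (α x (ξ x) * inner ℝ (Y x) (Y x)) := by
    have hW {y : M} (hy : y ∈ O) : inner ℝ (J y (ξ y)) (bracket Y (app J Y) y)
        = -(α y (ξ y) * inner ℝ (Y y) (Y y)) := by
      rw [(H.inner_bracket_orthogonal hOU hO hy hY hJY hYp hJYp).2, app, H.kahler.orthogonal]
    rw [H.inner_J_bracket_self hOU hO hxO (hY.bracket hJY hO), hW hxO,
      dirDeriv_congr hO hxO (fun y hy => hW hy), dirDeriv_neg,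
      dirDeriv_mul (H.contMDiffOn_alpha.mdifferentiableAt_of_isOpen H.isOpen hx)
        ((hY.inner hY).mdifferentiableAt_of_isOpen hO hxO),
      H.kahler.leviCivita.dirDeriv_inner hY hY hO hxO, real_inner_comm (nabla Y x (ξ x)) (Y x)]
    ring
  have e2 : inner ℝ (J x (ξ x)) (bracket (bracket ξ Y) (app J Y) x)
      = -(α x (ξ x) * (inner ℝ (nabla Y x (ξ x)) (Y x)
        - 1 / 2 * α x (ξ x) * inner ℝ (Y x) (Y x))) := by
    rw [(H.inner_bracket_orthogonal hOU hO hxO (hξ.bracket hY hO) hJY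
        (fun y hy => H.bracket_self_mem hOU hO hy hY hYp) hJYp).2, app, H.kahler.orthogonal,
      H.bracket_self_eq hOU hO hxO hY hYp, inner_sub_left, inner_smul_left, RCLike.conj_to_real]
  have e3 : inner ℝ (J x (ξ x)) (bracket Y (bracket ξ (app J Y)) x)
      = -(α x (ξ x) * (inner ℝ (nabla Y x (ξ x)) (Y x)
        - 1 / 2 * α x (ξ x) * inner ℝ (Y x) (Y x))) := by
    rw [(H.inner_bracket_orthogonal hOU hO hxO hY (hξ.bracket hJY hO) hYp
        (fun y hy => H.bracket_self_mem hOU hO hy hJY hJYp)).2,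
      H.bracket_self_eq hOU hO hxO hJY hJYp, H.kahler.parallel O hO Y hY x hxO, inner_sub_right,
      inner_smul_right, app, H.kahler.orthogonal, H.kahler.orthogonal,
      real_inner_comm (nabla Y x (ξ x)) (Y x)]
  rw [jac, inner_add_right, e2, e3] at e1
  have hY1 : inner ℝ (Y x) (Y x) ≠ 0 := inner_self_ne_zero.2 hY0
  apply mul_left_cancel₀ hY1
  linarith

theorem dirDeriv_alpha (hx : x ∈ nonvanishing α) (v : TangentSpace 𝓘(ℝ, E) x) :
    dirDeriv (fun y => α y (ξ y)) x v
      = -(α x (ξ x) * (α x (ξ x) + leafCurvature J ξ x)) * inner ℝ (ξ x) v := by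
  conv_lhs => rw [H.eq_add hx v]
  rw [dirDeriv_add_vec, dirDeriv_add_vec, dirDeriv_smul_vec, dirDeriv_smul_vec,
    H.dirDeriv_alpha_self hx, H.dirDeriv_alpha_J_eq_zero hx,
    H.dirDeriv_alpha_of_mem_orthogonal hx (projPerp_mem v)]
  ring

theorem covDerivForm_flat (hOU : O ⊆ nonvanishing α) (hO : IsOpen O) (hx : x ∈ O)
    (hY : SmoothOn Y O) :
    covDerivForm nabla (flat ξ) X Y x = inner ℝ (nabla ξ x (X x)) (Y x) := by
  have h := H.kahler.leviCivita.dirDeriv_inner (H.smoothOn.mono hOU) hY hO hx (X x)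
  exact sub_eq_iff_eq_add.2 h

/-- By zero torsion, dη is twice the skew part of ∇ξ, which vanishes. -/
theorem isClosedFormOn_flat : IsClosedFormOn (flat ξ) (nonvanishing α) := by
  intro O hO hOU X Y hX hY x hx
  have h1 := H.covDerivForm_flat (X := X) hOU hO hx hY
  have h2 := H.covDerivForm_flat (X := Y) hOU hO hx hX
  have h3 := H.inner_nabla_comm (hOU hx) (X x) (Y x)
  rw [covDerivForm] at h1 h2
  rw [extDerivForm, H.kahler.leviCivita.bracket_eq hX hY hO hx, map_sub]
  linarith

theorem hasMFDerivAt_log_norm_alpha (hx : x ∈ nonvanishing α) :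
    HasMFDerivAt 𝓘(ℝ, E) 𝓘(ℝ, ℝ) (fun y => Real.log ‖α y‖) x
      (-(‖α x‖ + leafCurvature J ξ x) • flat ξ x) := by
  have hc := (H.contMDiffOn_alpha.mdifferentiableAt_of_isOpen H.isOpen hx).hasMFDerivAt
  have hlog := (Real.hasDerivAt_log (H.alpha_pos hx).ne').hasFDerivAt.hasMFDerivAt
  -- |α| = α(ξ) is known only on the open set where α is nonzero, so the functions are compared near
  -- x.
  have h := (hlog.comp x hc).congr_of_eventuallyEq (f₁ := fun y => Real.log ‖α y‖)
    (Filter.eventually_of_mem (H.isOpen.mem_nhds hx) fun y hy => by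
      exact congrArg Real.log (H.norm_alpha hy))
  refine h.congr_mfderiv (ContinuousLinearMap.ext fun v => Eq.symm ?_)
  have hv := H.dirDeriv_alpha hx v
  change -(‖α x‖ + leafCurvature J ξ x) * inner ℝ (ξ x) v
    = dirDeriv (fun y => α y (ξ y)) x v * (α x (ξ x))⁻¹
  have := (H.alpha_pos hx).ne'
  rw [hv, H.norm_alpha hx]
  field_simp

theorem dirDeriv_leafCurvature_wedge (hx : x ∈ nonvanishing α) (v w : TangentSpace 𝓘(ℝ, E) x) :
    dirDeriv (leafCurvature J ξ) x v * flat ξ x w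
      - dirDeriv (leafCurvature J ξ) x w * flat ξ x v = 0 := by
  obtain ⟨O', hO'U, hO', hx', X, hX', rfl⟩ := exists_smoothOn_eq H.isOpen hx v
  obtain ⟨O, hOO', hO, hxO, Y, hY, rfl⟩ := exists_smoothOn_eq hO' hx' w
  have hX := hX'.mono hOO'
  have hOU := hOO'.trans hO'U
  have hξ := H.smoothOn.mono hOU
  have hξ0 : ξ x ≠ 0 := norm_ne_zero_iff.1 (by rw [H.principal.norm_eq_one x hx]; exact one_ne_zero)
  have hc := H.contMDiffOn_alpha
  have hp := H.contMDiffOn_leafCurvature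
  have hF : ContMDiffOn 𝓘(ℝ, E) 𝓘(ℝ, ℝ) ∞
      (fun y => -(α y (ξ y) * (α y (ξ y) + leafCurvature J ξ y))) (nonvanishing α) :=
    (hc.mul (hc.add hp)).neg
  have hcp : ContMDiffOn 𝓘(ℝ, E) 𝓘(ℝ, ℝ) ∞
      (fun y => α y (ξ y) + leafCurvature J ξ y) (nonvanishing α) := hc.add hp
  have dd {f : M → ℝ} (hf : ContMDiffOn 𝓘(ℝ, E) 𝓘(ℝ, ℝ) ∞ f (nonvanishing α)) :=
    hf.mdifferentiableAt_of_isOpen H.isOpen hx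
  -- This is d(dc) = 0 on X, Y for dc = Fη with F = -c(c + p); ξ serves as the nonvanishing
  -- auxiliary field.
  have key := dirDeriv_bracket hX hY hξ hξ0 (hc.mono hOU) ((hF.mono hOU).mul (hξ.inner hX))
    ((hF.mono hOU).mul (hξ.inner hY)) (fun y hy => H.dirDeriv_alpha (hOU hy) _)
    (fun y hy => H.dirDeriv_alpha (hOU hy) _) hO hxO
  have hclosed := H.isClosedFormOn_flat O hO hOU X Y hX hY x hxO
  have dF (u : TangentSpace 𝓘(ℝ, E) x) :
      dirDeriv (fun y => -(α y (ξ y) * (α y (ξ y) + leafCurvature J ξ y))) x u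
      = -(α x (ξ x) * (dirDeriv (fun y => α y (ξ y)) x u + dirDeriv (leafCurvature J ξ) x u)
        + (α x (ξ x) + leafCurvature J ξ x) * dirDeriv (fun y => α y (ξ y)) x u) := by
    rw [dirDeriv_neg, dirDeriv_mul (dd hc) (dd hcp), dirDeriv_add (dd hc) (dd hp)]
  change dirDeriv (fun y => inner ℝ (ξ y) (Y y)) x (X x)
    - dirDeriv (fun y => inner ℝ (ξ y) (X y)) x (Y x) - inner ℝ (ξ x) (bracket X Y x) = 0 at hclosed
  rw [Pi.mul_def, Pi.mul_def, dirDeriv_mul (dd hF) ((hξ.inner hY).mdifferentiableAt_of_isOpen hO hxO),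
    dirDeriv_mul (dd hF) ((hξ.inner hX).mdifferentiableAt_of_isOpen hO hxO), dF, dF,
    H.dirDeriv_alpha hx, H.dirDeriv_alpha hx, H.dirDeriv_alpha hx] at key
  change dirDeriv (leafCurvature J ξ) x (X x) * inner ℝ (ξ x) (Y x)
      - dirDeriv (leafCurvature J ξ) x (Y x) * inner ℝ (ξ x) (X x) = 0
  apply mul_left_cancel₀ (H.alpha_pos hx).ne'
  -- The dη term carries the factor F and is removed by `hclosed`; the dc ∧ η terms cancel because
  -- dc is a multiple of η.
  linear_combination key + α x (ξ x) * (α x (ξ x) + leafCurvature J ξ x) * -hclosed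

end IsPrincipalFoliation

end StructureEquations

end HomotheticFoliation

theorem proposition2p1
    {E : Type*} [NormedAddCommGroup E] [NormedSpace ℝ E] [FiniteDimensional ℝ E]
    {M : Type*} [TopologicalSpace M] [T2Space M] [SecondCountableTopology M]
    [ChartedSpace E M] [IsManifold 𝓘(ℝ, E) ∞ M]
    [RiemannianBundle (fun x : M => TangentSpace 𝓘(ℝ, E) x)]
    [IsContMDiffRiemannianBundle 𝓘(ℝ, E) ∞ E (fun x : M => TangentSpace 𝓘(ℝ, E) x)]
    (n : ℕ) (hn : 2 ≤ n) (hdim : Module.finrank ℝ E = 2 * n)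
    (nabla : Connection E M) (J : EndField E M) (hK : IsKahler nabla J)
    (D : TangentDistribution E M) (hF : IsFoliation 2 D) (hJ : IsComplex J D)
    (α : OneForm E M) (hhom : IsHomothetic D α)
    (hgeo : IsTotallyGeodesic nabla D) (hhol : IsHolomorphic J D)
    (ξ : VecField E M) (hξ : IsPrincipalFieldOn nabla J D (nonvanishing α) ξ) :
    ∃ p : M → ℝ, ContMDiffOn 𝓘(ℝ, E) 𝓘(ℝ, ℝ) ∞ p (nonvanishing α) ∧
      (∀ x ∈ nonvanishing α, nabla (app J ξ) x (app J ξ x) = p x • ξ x) ∧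
      IsClosedFormOn (flat ξ) (nonvanishing α) ∧
      (∀ x ∈ nonvanishing α, nabla ξ x (ξ x) = 0) ∧
      (∀ x ∈ nonvanishing α, HasMFDerivAt 𝓘(ℝ, E) 𝓘(ℝ, ℝ) (fun y => Real.log ‖α y‖) x
        (-(‖α x‖ + p x) • flat ξ x)) ∧
      (∀ x ∈ nonvanishing α, ∀ v w : TangentSpace 𝓘(ℝ, E) x,
        dirDeriv p x v * flat ξ x w - dirDeriv p x w * flat ξ x v = 0) ∧
      (∀ O : Set M, IsOpen O → O ⊆ nonvanishing α → ∀ X Y : VecField E M,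
        SmoothOn X O → SmoothOn Y O → ∀ x ∈ O,
          covDerivForm nabla (flat ξ) X Y x =
            1 / 2 * ‖α x‖ * metricPerp D x (X x) (Y x)
              - p x * flat (app J ξ) x (X x) * flat (app J ξ) x (Y x)) := by
  have H : IsPrincipalFoliation nabla J D α ξ :=
    ⟨by omega, hK, hF, hJ, hhom, hgeo, hhol, hξ⟩
  refine ⟨leafCurvature J ξ, H.contMDiffOn_leafCurvature, fun x hx => H.nabla_J hx,
    H.isClosedFormOn_flat, fun x hx => H.nabla_self hx,
    fun x hx => H.hasMFDerivAt_log_norm_alpha hx,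
    fun x hx v w => H.dirDeriv_leafCurvature_wedge hx v w, ?_⟩
  intro O hO hOU X Y hX hY x hx
  rw [H.covDerivForm_flat hOU hO hx hY, H.inner_nabla (hOU hx), H.norm_alpha (hOU hx)]
  rfl
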